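/- Let $\mathbb K$ be an algebraic number field of degree $\kappa=[\mathbb K:\mathbb Q]$ with ring of integers $\mathbb Z_{\mathbb K}$, let $V_0$ and $V_\infty$ be its sets of non-Archimedean and Archimedean places, and let $\mathbb K_v$ be the completion at $v$. For a place $v\mid p$ ($p$ a prime or $\infty$) let $|\cdot|_v$ be the absolute value extending the standard $|\cdot|_p$ of $\mathbb Q$, let $\kappa_v=[\mathbb K_v:\mathbb Q_p]$ (with $\mathbb Q_\infty=\mathbb R$), and put $\|x\|_v=|x|_v^{\kappa_v/\kappa}$. Let $m\ge 1$ and let $\alpha_1,\dots,\alpha_m\in\mathbb Z_{\mathbb K}\setminus\{0\}$ be pairwise distinct. For every $v\in V_0$ and every $j$ the series $F_v(\alpha_j)=\sum_{n=0}^\infty n!\,\alpha_j^n$ converges in $\mathbb K_v$. Define $$c_1=\prod_{v\in V_\infty}\Bigl(\bigl(\max_{1\le j\le m}\{1,\|\alpha_j\|_v\}\bigr)^m\prod_{i=1}^m\bigl(\|\alpha_i\|_v+\max_{1\le j\le m}\{1,\|\alpha_j\|_v\}\bigr)\Bigr)$$ and, for $V\subseteq V_0$, $$c_2(V)=c_1\prod_{v\in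 V}\max_{1\le j\le m}\|\alpha_j\|_v .$$ For $V\subseteq V_0$ consider the condition $$(*)\qquad \limsup_{l\to\infty}\; c_2(V)^l\,(ml+m)^\kappa\,(ml+m)!\prod_{v\in V}\|(ml)!\,l!\|_v=0 .$$ (a) Let $\lambda_0,\lambda_1,\dots,\lambda_m\in\mathbb Z_{\mathbb K}$ be not all zero, and let $V\subseteq V_0$ satisfy $(*)$. Then there is a $v'\in V$ with $$\lambda_0+\lambda_1F_{v'}(\alpha_1)+\dots+\lambda_mF_{v'}(\alpha_m)\ne 0\quad\text{in }\mathbb K_{v'} .$$ (b) Every $V\subseteq V_0$ whose complement $V_0\setminus V$ is finite satisfies $(*)$. -/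

import Mathlib

open scoped Nat

noncomputable section

namespace EulerSeries

open NumberField

variable {K : Type*} [Field K] [NumberField K]

/-- The completion `K_v` of `K` at a non-Archimedean place `v`. -/
abbrev Completion (v : FinitePlace K) : Type _ :=
  v.maximalIdeal.adicCompletion K

/-- The canonical embedding `K → K_v`. -/
def toCompletion (v : FinitePlace K) : K →+* Completion v :=
  FinitePlace.embedding v.maximalIdeal

/-- The normalised absolute value `‖x‖_v = |x|_v ^ (κ_v / κ)` at a non-Archimedean place `v ∣ p`,
where `|p|_v = 1 / p`, `κ_v = [K_v : ℚ_p]` and `κ = [K : ℚ]`. The value `v x` of Mathlib's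
`FinitePlace` is `N(𝔭_v) ^ (-ord_v x)`, that is, `|x|_v ^ κ_v`. -/
def finNorm (v : FinitePlace K) (x : K) : ℝ :=
  v x ^ (1 / (Module.finrank ℚ K : ℝ))

/-- The normalised absolute value `‖x‖_v = |x|_v ^ (κ_v / κ)` at an Archimedean place `v`, where
`κ_v = v.mult` is `1` for a real and `2` for a complex place. -/
def infNorm (v : InfinitePlace K) (x : K) : ℝ :=
  v x ^ ((v.mult : ℝ) / (Module.finrank ℚ K : ℝ))

/-- The value `F_v(t) = ∑ n! t ^ n` of Euler's series, summed in `K_v`. -/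
def F (v : FinitePlace K) (t : K) : Completion v :=
  ∑' n : ℕ, (n ! : Completion v) * toCompletion v t ^ n

/-- `max {1, ‖α_1‖_v, …, ‖α_m‖_v}` at an Archimedean place. -/
def infMax {m : ℕ} (α : Fin m → 𝓞 K) (v : InfinitePlace K) : ℝ :=
  max 1 (⨆ j, infNorm v (α j : K))

/-- `c₁(α) = ∏_{v ∣ ∞} (max {1, ‖α_j‖_v} ^ m * ∏_i (‖α_i‖_v + max {1, ‖α_j‖_v}))`. -/
def c₁ {m : ℕ} (α : Fin m → 𝓞 K) : ℝ :=
  ∏ v : InfinitePlace K, (infMax α v ^ m * ∏ i, (infNorm v (α i : K) + infMax α v))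

/-- `c₂(α, V) = c₁(α) * ∏_{v ∈ V} max {‖α_1‖_v, …, ‖α_m‖_v}`. If all `α_j` are non-zero, then
all but finitely many factors are `1`. -/
def c₂ {m : ℕ} (α : Fin m → 𝓞 K) (V : Set (FinitePlace K)) : ℝ :=
  c₁ α * ∏ᶠ v : V, ⨆ j, finNorm (v : FinitePlace K) (α j : K)

/-- The term `c₂ ^ l * (m l + m) ^ κ * (m l + m)! * ∏_{v ∈ V} ‖(m l)! l!‖_v`. -/
def term {m : ℕ} (α : Fin m → 𝓞 K) (V : Set (FinitePlace K)) (l : ℕ) : ℝ :=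
  c₂ α V ^ l * ((m * l + m : ℕ) : ℝ) ^ Module.finrank ℚ K * ((m * l + m)! : ℝ) *
    ∏ᶠ v : V, finNorm (v : FinitePlace K) (((m * l)! * l ! : ℕ) : K)

/-- The condition `limsup_{l → ∞} c₂ ^ l (m l + m) ^ κ (m l + m)! ∏_{v ∈ V} ‖(m l)! l!‖_v = 0`.
The limsup is taken in the extended reals, so that it is `⊤` for an unbounded sequence. -/
def LimsupCondition {m : ℕ} (α : Fin m → 𝓞 K) (V : Set (FinitePlace K)) : Prop :=
  Filter.limsup (fun l : ℕ => ((term α V l : ℝ) : EReal)) Filter.atTop = 0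

end EulerSeries

end

/-! Suppose the linear form vanishes in `K_v` for every `v ∈ V`. Let `b_h` be its truncation before
the terms `h! α_j ^ h`, and let `A = ∏ (X - α_j)`. For `p = A ^ l * X ^ i = ∑ σ_h X ^ h` with `i <
m`, and `M = m l + m`, put `T(N) = ∑ σ_h (M! / h!) b_{N + h}`. The integer `W = T(0)` of `K` is
estimated at every place.

At `v ∈ V`: since `(n + h)! / h! = n! * (n + h).choose n`, the difference `T(N) - T(0)` is a
combination of values at the `α_j` of Hasse derivatives of `X ^ n * p` (`padeForm_sub`). Those with
`n < l` vanish because `A ^ l ∣ p`, so `M! l!` and an `l`-th power of the size of the `α_j` remain.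
The vanishing of the form gives `T(N) → 0`, so `T(0)` obeys the same bound (`apply_padeForm_le`). At
other finite places `‖W‖_v ≤ 1`, and at the infinite ones `W` is bounded by the length of `p`
(`infNorm_padeForm_le`). If `W ≠ 0`, the product formula yields `1 ≤ D * term α V l` with `D`
independent of `l`, against the limsup condition.

That `W ≠ 0` for some arbitrarily large `l` and some `i < m` is algebraic. Up to `M!`, `W` is the
value at `p` of the functional `Φ : X ^ h ↦ b_h / h!`, and the recursion for `b` becomes `Φ(X (X p)'
- p) = ∑ μ_j p(α_j)`. This identity prevents `Φ` from killing a nonzero ideal generated by a power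
of `A`.

For (b), the product formula turns the product over `V` into `1 / ((m l)! l!)`, up to a factor
geometric in `l` from the finitely many missing places; the surviving `l!` beats every geometric
factor. -/

namespace EulerSeries

open Polynomial

/-! ### Remainder formula for the Padé-type approximation. -/

section PadeForm

variable {R : Type*} [CommRing R] {m : ℕ}

/-- The truncation `λ₀ + ∑_j μ_j ∑_{n < h} n! α_j ^ n` of a linear form in values of Euler's
series. -/
def truncatedForm (c : R) (μ α : Fin m → R) (h : ℕ) : R :=
  c + ∑ j, μ j * ∑ n ∈ Finset.range h, (n ! : R) * α j ^ n

/-- The value at `p = ∑ σ_h X ^ h` of the linear functional `X ^ h ↦ M! / h! * b_{N + h}`, where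
`b` is the sequence of truncations of the linear form. -/
def padeForm (c : R) (μ α : Fin m → R) (M N : ℕ) (p : R[X]) : R :=
  ∑ h ∈ Finset.range (M + 1), p.coeff h * (M ! / h ! : ℕ) * truncatedForm c μ α (N + h)

theorem truncatedForm_succ (c : R) (μ α : Fin m → R) (h : ℕ) :
    truncatedForm c μ α (h + 1) = truncatedForm c μ α h + h ! * ∑ j, μ j * α j ^ h := by
  simp only [truncatedForm, Finset.sum_range_succ, mul_add, Finset.sum_add_distrib,
    Finset.mul_sum, ← add_assoc]
  congr 1
  exact Finset.sum_congr rfl fun j _ => by ring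

theorem truncatedForm_add_sub (c : R) (μ α : Fin m → R) (N h : ℕ) :
    truncatedForm c μ α (N + h) - truncatedForm c μ α h =
      ∑ j, μ j * ∑ n ∈ Finset.range N, ((n + h)! : R) * α j ^ (n + h) := by
  simp only [truncatedForm, add_sub_add_left_eq_sub, ← Finset.sum_sub_distrib, ← mul_sub]
  refine Finset.sum_congr rfl fun j _ => ?_
  rw [add_comm N h, Finset.sum_range_add, add_sub_cancel_left]
  simp only [add_comm h]

/-- The factor `X ^ n` makes the binomials `(n + h).choose n` appear without lowering exponents;
these are what `(n + h)! / h!` leaves after `n!` is taken out. -/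
theorem eval_hasseDeriv_X_pow_mul {p : R[X]} {M : ℕ} (hp : p.natDegree ≤ M) (n : ℕ) (a : R) :
    (hasseDeriv n (X ^ n * p)).eval a =
      ∑ h ∈ Finset.range (M + 1), p.coeff h * ((n + h).choose n : R) * a ^ h := by
  rw [eval_eq_sum_range' (n := M + 1)]
  · refine Finset.sum_congr rfl fun h _ => ?_
    rw [hasseDeriv_coeff, add_comm h n, add_comm n h, coeff_X_pow_mul, add_comm h n]
    ring
  · have h1 := natDegree_hasseDeriv_le (X ^ n * p) n
    have h2 : (X ^ n * p).natDegree ≤ n + p.natDegree :=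
      natDegree_mul_le.trans (by gcongr; exact natDegree_X_pow_le n)
    omega

/-- Hasse derivatives at `a` are Taylor coefficients at `a`, and the Taylor shift turns `X - a` into
`X`. -/
theorem eval_hasseDeriv_eq_zero {p : R[X]} {a : R} {l n : ℕ} (hp : (X - C a) ^ l ∣ p)
    (hn : n < l) : (hasseDeriv n p).eval a = 0 := by
  obtain ⟨q, rfl⟩ := hp
  rw [← taylor_coeff, taylor_mul, taylor_pow]
  have : taylor a (X - C a) = X := by simp
  rw [this, coeff_X_pow_mul', if_neg (by omega)]

theorem padeForm_sub (c : R) (μ α : Fin m → R) (M N : ℕ) {p : R[X]} (hp : p.natDegree ≤ M) :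
    padeForm c μ α M N p - padeForm c μ α M 0 p =
      M ! * ∑ j, μ j * ∑ n ∈ Finset.range N,
        (n ! : R) * α j ^ n * (hasseDeriv n (X ^ n * p)).eval (α j) := by
  have key : ∀ h ∈ Finset.range (M + 1),
      p.coeff h * (M ! / h ! : ℕ) * truncatedForm c μ α (N + h) -
        p.coeff h * (M ! / h ! : ℕ) * truncatedForm c μ α (0 + h) =
      ∑ j, ∑ n ∈ Finset.range N, (M ! : R) * (μ j * ((n ! : R) * α j ^ n *
        (p.coeff h * ((n + h).choose n : R) * α j ^ h))) := by
    intro h hh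
    rw [← mul_sub, zero_add, truncatedForm_add_sub, Finset.mul_sum]
    refine Finset.sum_congr rfl fun j _ => ?_
    rw [Finset.mul_sum, Finset.mul_sum]
    refine Finset.sum_congr rfl fun n _ => ?_
    have h1 : M ! / h ! * (n + h)! = M ! * (n ! * (n + h).choose n) := by
      have hd : h ! ∣ M ! := Nat.factorial_dvd_factorial (by simpa [Nat.lt_succ_iff] using hh)
      have h2 : (n + h).choose n * n ! * h ! = (n + h)! := by
        have := Nat.choose_mul_factorial_mul_factorial (Nat.le_add_right n h)
        rwa [Nat.add_sub_cancel_left] at this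
      calc M ! / h ! * (n + h)! = (M ! / h ! * h !) * (n ! * (n + h).choose n) := by
            rw [← h2]; ring
        _ = _ := by rw [Nat.div_mul_cancel hd]
    have h1' : ((M ! / h ! : ℕ) : R) * (n + h)! = M ! * (n ! * (n + h).choose n) := by
      exact_mod_cast congrArg (Nat.cast : ℕ → R) h1
    rw [pow_add]
    linear_combination (p.coeff h * μ j * α j ^ n * α j ^ h) * h1'
  rw [padeForm, padeForm, ← Finset.sum_sub_distrib, Finset.sum_congr rfl key, Finset.sum_comm,
    Finset.mul_sum]
  refine Finset.sum_congr rfl fun j _ => ?_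
  rw [Finset.sum_comm, Finset.mul_sum, Finset.mul_sum]
  refine Finset.sum_congr rfl fun n _ => ?_
  rw [eval_hasseDeriv_X_pow_mul hp]
  simp only [Finset.mul_sum]

end PadeForm

/-! ### Non-vanishing of the approximation for arbitrarily large `l`. -/

section NonVanishing

variable {K : Type*} [Field K] {m : ℕ}

/-- The linear functional `X ^ h ↦ b_h / h!`, where `b` is the sequence of truncations of the linear
form `λ₀ + ∑_j μ_j F(α_j)`. -/
noncomputable def padeFunctional (c : K) (μ α : Fin m → K) : K[X] →ₗ[K] K :=
  lsum fun h => (truncatedForm c μ α h / h !) • LinearMap.id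

theorem padeFunctional_monomial (c : K) (μ α : Fin m → K) (n : ℕ) (a : K) :
    padeFunctional c μ α (monomial n a) = truncatedForm c μ α n / n ! * a := by
  simp [padeFunctional, lsum_apply, sum_monomial_index]

theorem padeForm_zero [CharZero K] (c : K) (μ α : Fin m → K) {M : ℕ} {p : K[X]}
    (hp : p.natDegree ≤ M) :
    padeForm c μ α M 0 p = M ! * padeFunctional c μ α p := by
  have h1 : padeFunctional c μ α p = p.sum fun h a => truncatedForm c μ α h / h ! * a := by
    simp [padeFunctional, lsum_apply]
  rw [h1, sum_over_range' p (by simp) (M + 1) (by omega), padeForm, Finset.mul_sum]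
  refine Finset.sum_congr rfl fun h hh => ?_
  have hd : h ! ∣ M ! := Nat.factorial_dvd_factorial (by simpa [Nat.lt_succ_iff] using hh)
  rw [Nat.cast_div hd (by exact_mod_cast h.factorial_ne_zero), zero_add]
  ring

/-- On `X ^ n` the argument is `(n + 1) X ^ (n + 1) - X ^ n`, so the left side is `(b_{n+1} - b_n) /
n!`: the identity encodes the recursion `truncatedForm_succ`. -/
theorem padeFunctional_derivative [CharZero K] (c : K) (μ α : Fin m → K) (p : K[X]) :
    padeFunctional c μ α (X * derivative (X * p) - p) = ∑ j, μ j * p.eval (α j) := by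
  induction p using Polynomial.induction_on' with
  | add p q hp hq =>
    have : X * derivative (X * (p + q)) - (p + q) =
        (X * derivative (X * p) - p) + (X * derivative (X * q) - q) := by
      rw [mul_add, derivative_add]; ring
    rw [this, map_add, hp, hq, ← Finset.sum_add_distrib]
    simp [mul_add]
  | monomial n a =>
    rw [X_mul_monomial, derivative_monomial, X_mul_monomial, Nat.add_sub_cancel, map_sub,
      padeFunctional_monomial, padeFunctional_monomial, truncatedForm_succ, Nat.factorial_succ]
    have h1 : (n ! : K) ≠ 0 := by exact_mod_cast n.factorial_ne_zero
    have h2 : ((n + 1 : ℕ) : K) ≠ 0 := by exact_mod_cast n.succ_ne_zero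
    have h3 : ∑ j, μ j * (monomial n a).eval (α j) = (∑ j, μ j * α j ^ n) * a := by
      simp only [eval_monomial, Finset.sum_mul]
      exact Finset.sum_congr rfl fun j _ => by ring
    rw [h3]
    push_cast at h2 ⊢
    field_simp
    ring

theorem exists_padeFunctional_ne_zero [CharZero K] {c : K} {μ α : Fin m → K}
    (hne : c ≠ 0 ∨ ∃ j, μ j ≠ 0) (hα : ∀ j, α j ≠ 0) (hinj : Function.Injective α) (l : ℕ) :
    ∃ q : K[X], padeFunctional c μ α ((∏ j, (X - C (α j))) ^ l * q) ≠ 0 := by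
  by_contra! hzero
  set Φ := padeFunctional c μ α with hΦ
  -- The largest ideal contained in the kernel of `Φ`. Its generator `g` divides `A ^ l`, and the
  -- aim is that `g` is a unit.
  let I : Ideal K[X] :=
    { carrier := {p | ∀ q, Φ (p * q) = 0}
      add_mem' := fun {a b} ha hb q => by rw [add_mul, map_add, ha q, hb q, add_zero]
      zero_mem' := fun q => by simp
      smul_mem' := fun r p hp q => by
        rw [smul_eq_mul, mul_comm r, mul_assoc]; exact hp _ }
  have hI : ∀ p, p ∈ I ↔ ∀ q, Φ (p * q) = 0 := fun p => Iff.rfl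
  obtain ⟨g, hg⟩ := (IsPrincipalIdealRing.principal I).principal
  have hgI : ∀ p, p ∈ I ↔ g ∣ p := fun p => by
    rw [hg]; exact Ideal.mem_span_singleton
  have hgA : g ∣ (∏ j, (X - C (α j))) ^ l := (hgI _).1 hzero
  have hA0 : (∏ j, (X - C (α j))) ^ l ≠ 0 :=
    pow_ne_zero _ (Finset.prod_ne_zero_iff.2 fun j _ => X_sub_C_ne_zero _)
  have hg0 : g ≠ 0 := ne_zero_of_dvd_ne_zero hA0 hgA
  have hE : ∀ p, Φ (X * derivative (X * p) - p) = ∑ j, μ j * p.eval (α j) :=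
    padeFunctional_derivative c μ α
  have hgg : g ∈ I := (hgI g).2 dvd_rfl
  have hunit : IsUnit g := by
    by_contra hu
    obtain ⟨r, hr, hrg⟩ := WfDvdMonoid.exists_irreducible_factor hu hg0
    obtain ⟨i, -, hi⟩ := (hr.prime.dvd_finsetProd_iff _).1
      (hr.prime.dvd_of_dvd_pow (hrg.trans hgA))
    have hroot : g.IsRoot (α i) :=
      dvd_iff_isRoot.1 <| ((hr.dvd_irreducible_iff_associated
        (irreducible_X_sub_C _)).1 hi).symm.dvd.trans hrg
    set f : K[X] := ∏ j ∈ Finset.univ.erase i, (X - C (α j)) with hf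
    -- The derivative identity at `g * f * q` has right side zero, since `g * f` vanishes at every
    -- `α_j`. Modulo multiples of `g`, only `X ^ 2 * f * g' * q` remains on the left.
    have hmem : X ^ 2 * f * derivative g ∈ I := by
      rw [hI]
      intro q
      have h1 := hE (g * (f * q))
      have h2 : ∑ j, μ j * (g * (f * q)).eval (α j) = 0 := by
        refine Finset.sum_eq_zero fun j _ => ?_
        rcases eq_or_ne j i with rfl | hj
        · simp [hroot.eq_zero]
        · have : f.eval (α j) = 0 := by
            rw [hf, eval_prod]
            exact Finset.prod_eq_zero (Finset.mem_erase.2 ⟨hj, Finset.mem_univ _⟩) (by simp)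
          simp [this]
      have h3 : X * derivative (X * (g * (f * q))) - g * (f * q) =
          X ^ 2 * f * derivative g * q +
            g * ((X - 1) * (f * q) + X ^ 2 * derivative (f * q)) := by
        rw [derivative_mul, derivative_mul, derivative_X]
        ring
      rwa [h2, h3, map_add, hgg, add_zero] at h1
    have hdvd : (X - C (α i)) ^ g.rootMultiplicity (α i) ∣ X ^ 2 * f * derivative g :=
      (pow_rootMultiplicity_dvd g (α i)).trans ((hgI _).1 hmem)
    -- As `α i ≠ 0` and the `α j` are distinct, the whole power of `X - α i` must divide `g'`, which
    -- is impossible in characteristic zero.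
    have hcop : IsCoprime ((X - C (α i)) ^ g.rootMultiplicity (α i)) (X ^ 2 * f) := by
      refine IsCoprime.pow_left ((irreducible_X_sub_C _).coprime_iff_not_dvd.2 fun hd => ?_)
      rw [dvd_iff_isRoot, IsRoot, eval_mul, eval_pow, eval_X, hf, eval_prod] at hd
      refine mul_ne_zero (pow_ne_zero _ (hα i)) (Finset.prod_ne_zero_iff.2 fun j hj => ?_) hd
      rw [eval_sub, eval_X, eval_C, sub_ne_zero]
      exact fun h => (Finset.mem_erase.1 hj).1 (hinj h).symm
    have hd := hcop.dvd_of_dvd_mul_left hdvd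
    have hder : derivative g ≠ 0 := fun h => by
      have := derivative_eq_zero.1 h
      rw [eq_C_of_natDegree_eq_zero this] at hroot hg0
      simp only [IsRoot, eval_C] at hroot
      simp [hroot] at hg0
    have := (le_rootMultiplicity_iff hder).2 hd
    rw [derivative_rootMultiplicity_of_root hroot] at this
    -- Positivity excludes the case where the truncated `k - 1` equals `k`.
    have := (rootMultiplicity_pos hg0).2 hroot
    omega
  have hΦ0 : ∀ p, Φ p = 0 := fun p => by
    have : p ∈ I := (hgI p).2 hunit.dvd
    simpa using this 1
  have hμ : ∀ i, μ i = 0 := fun i => by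
    -- This polynomial vanishes at every `α j` except `α i`, which isolates `μ i`.
    have h1 := hE (∏ j ∈ Finset.univ.erase i, (X - C (α j)))
    rw [hΦ0, Finset.sum_eq_single i] at h1
    · refine (mul_eq_zero.1 h1.symm).resolve_right ?_
      rw [eval_prod]
      refine Finset.prod_ne_zero_iff.2 fun j hj => ?_
      rw [eval_sub, eval_X, eval_C, sub_ne_zero]
      exact fun h => (Finset.mem_erase.1 hj).1 (hinj h).symm
    · intro j _ hj
      rw [eval_prod, Finset.prod_eq_zero (Finset.mem_erase.2 ⟨hj, Finset.mem_univ _⟩) (by simp),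
        mul_zero]
    · simp
  have hc : c = 0 := by
    have := hΦ0 (monomial 0 1)
    rw [hΦ, padeFunctional_monomial] at this
    simpa [truncatedForm] using this
  rcases hne with h | ⟨j, h⟩
  · exact h hc
  · exact h (hμ j)

/-- A linear functional that vanishes on `A ^ l * X ^ i` for all `l ≥ l₀` and `i < deg A` vanishes on
the ideal generated by `A ^ l₀`. -/
theorem map_pow_mul_eq_zero {A : K[X]} (hA : A.Monic) (hdeg : A.natDegree ≠ 0) (Φ : K[X] →ₗ[K] K)
    {l₀ : ℕ} (h : ∀ l ≥ l₀, ∀ i < A.natDegree, Φ (A ^ l * X ^ i) = 0) (q : K[X]) :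
    ∀ l ≥ l₀, Φ (A ^ l * q) = 0 := by
  induction hn : q.natDegree using Nat.strong_induction_on generalizing q with
  | _ n ih =>
    intro l hl
    have hlow : ∀ r : K[X], r.natDegree < A.natDegree → Φ (A ^ l * r) = 0 := fun r hr => by
      rw [as_sum_range' r _ hr, Finset.mul_sum, map_sum]
      refine Finset.sum_eq_zero fun i hi => ?_
      rw [← smul_X_eq_monomial, mul_smul_comm, map_smul, h l hl i (Finset.mem_range.1 hi),
        smul_zero]
    rcases lt_or_ge q.natDegree A.natDegree with hq | hq
    · exact hlow q hq
    -- The quotient has smaller degree but comes with `A ^ (l + 1)`, so the induction must cover all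
    -- `l ≥ l₀` at once.
    · rw [← modByMonic_add_div q A, mul_add, map_add,
        hlow _ (natDegree_modByMonic_lt q hA fun h1 => hdeg (by simp [h1])), zero_add,
        ← mul_assoc, ← pow_succ]
      refine ih _ ?_ _ rfl _ (by omega)
      rw [natDegree_divByMonic q hA]
      omega

theorem exists_padeFunctional_pow_ne_zero [CharZero K] (hm : 1 ≤ m) {c : K} {μ α : Fin m → K}
    (hne : c ≠ 0 ∨ ∃ j, μ j ≠ 0) (hα : ∀ j, α j ≠ 0) (hinj : Function.Injective α) (l₀ : ℕ) :
    ∃ l ≥ l₀, ∃ i < m, padeFunctional c μ α ((∏ j, (X - C (α j))) ^ l * X ^ i) ≠ 0 := by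
  by_contra! hcon
  obtain ⟨q, hq⟩ := exists_padeFunctional_ne_zero hne hα hinj l₀
  have hdeg : (∏ j, (X - C (α j))).natDegree = m := by
    simp
  refine hq (map_pow_mul_eq_zero (monic_prod_X_sub_C α Finset.univ) (by omega) _ ?_ q l₀ le_rfl)
  rwa [hdeg]

end NonVanishing

end EulerSeries

namespace EulerSeries

open NumberField Polynomial Filter Topology

/-! ### Estimates at the non-Archimedean places. -/

section FinitePlaces

variable {K : Type*} [Field K] [NumberField K] (v : FinitePlace K)

theorem norm_toCompletion (x : K) : ‖toCompletion v x‖ = v x :=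
  v.norm_embedding_eq x

theorem apply_integer_le_one (x : 𝓞 K) : v (x : K) ≤ 1 :=
  v.norm_embedding_eq (x : K) ▸ FinitePlace.norm_le_one K v.maximalIdeal x

theorem apply_natCast_le_one (n : ℕ) : v (n : K) ≤ 1 := by
  simpa using apply_integer_le_one v (n : 𝓞 K)

theorem apply_sum_le_of_forall_le {ι : Type*} {s : Finset ι} {f : ι → K} {B : ℝ} (hB : 0 ≤ B)
    (h : ∀ i ∈ s, v (f i) ≤ B) : v (∑ i ∈ s, f i) ≤ B := by
  rw [← norm_toCompletion, map_sum]
  refine IsUltrametricDist.norm_sum_le_of_forall_le_of_nonneg hB fun i hi => ?_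
  rw [norm_toCompletion]
  exact h i hi

theorem apply_natCast_le_of_dvd {a b : ℕ} (h : a ∣ b) : v (b : K) ≤ v (a : K) := by
  obtain ⟨c, rfl⟩ := h
  rw [Nat.cast_mul, map_mul]
  exact mul_le_of_le_one_right (apply_nonneg v _) (apply_natCast_le_one v c)

/-- The norm of the prime ideal is a nonzero natural number lying in it, so one of its prime factors
has absolute value below `1`. -/
theorem exists_prime_apply_lt_one : ∃ p : ℕ, p.Prime ∧ v (p : K) < 1 := by
  by_contra! hcon
  have hone : ∀ n : ℕ, n ≠ 0 → v (n : K) = 1 := fun n => by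
    induction n using Nat.recOnMul with
    | zero => simp
    | one => simp
    | prime p hp => exact fun _ => le_antisymm (apply_natCast_le_one v p) (hcon p hp)
    | mul a b ha hb =>
      intro h
      rw [Nat.cast_mul, map_mul, ha (left_ne_zero_of_mul h), hb (right_ne_zero_of_mul h), mul_one]
  have hmem : ((Ideal.absNorm v.maximalIdeal.asIdeal : ℕ) : 𝓞 K) ∈ v.maximalIdeal.asIdeal :=
    Ideal.absNorm_mem _
  have h1 := (FinitePlace.norm_lt_one_iff_mem K v.maximalIdeal _).2 hmem
  rw [FinitePlace.norm_embedding_eq, map_natCast] at h1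
  refine h1.ne (hone _ ?_)
  rw [Ne, Ideal.absNorm_eq_zero_iff]
  exact v.maximalIdeal.ne_bot

theorem apply_natCast_eq_one_of_not_dvd {p : ℕ} (hp : p.Prime) (hv : v (p : K) < 1) {n : ℕ}
    (hn : ¬ p ∣ n) : v (n : K) = 1 := by
  refine le_antisymm (apply_natCast_le_one v n) (not_lt.1 fun hlt => ?_)
  have hint : ∀ z : ℤ, v (z : K) ≤ 1 := fun z => by
    simpa using apply_integer_le_one v (z : 𝓞 K)
  have hcop : IsCoprime (p : ℤ) (n : ℤ) :=
    Nat.isCoprime_iff_coprime.2 ((Nat.Prime.coprime_iff_not_dvd hp).2 hn)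
  obtain ⟨a, b, hab⟩ := hcop
  have h1 : (a : K) * p + b * n = 1 := by exact_mod_cast congrArg (Int.cast : ℤ → K) hab
  have h2 := v.add_le ((a : K) * p) (b * n)
  rw [h1, map_one, map_mul, map_mul] at h2
  have h3 : v (a : K) * v (p : K) < 1 :=
    (mul_le_of_le_one_left (apply_nonneg v _) (hint a)).trans_lt hv
  have h4 : v (b : K) * v (n : K) < 1 :=
    (mul_le_of_le_one_left (apply_nonneg v _) (hint b)).trans_lt hlt
  exact (max_lt h3 h4).not_ge h2

/-- With `b = v p`, this is Legendre's bound: `p` divides `n!` at most `n` times. -/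
theorem exists_le_apply_factorial : ∃ b : ℝ, 0 < b ∧ ∀ n : ℕ, b ^ n ≤ v ((n ! : ℕ) : K) := by
  obtain ⟨p, hp, hv⟩ := exists_prime_apply_lt_one v
  have hp0 : 0 < v (p : K) := FinitePlace.pos_iff.2 (by exact_mod_cast hp.ne_zero)
  refine ⟨v (p : K), hp0, fun n => ?_⟩
  obtain ⟨u, hu⟩ : p ^ padicValNat p n ! ∣ n ! := pow_padicValNat_dvd
  have : Fact p.Prime := ⟨hp⟩
  have hnd : ¬ p ∣ u := fun ⟨w, hw⟩ => by
    refine pow_succ_padicValNat_not_dvd (p := p) n.factorial_ne_zero ⟨w, ?_⟩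
    rw [hw, ← mul_assoc, ← pow_succ] at hu
    exact hu
  have hle : padicValNat p n ! ≤ n := by
    have h1 := sub_one_mul_padicValNat_factorial (p := p) n
    have h2 : 1 * padicValNat p n ! ≤ (p - 1) * padicValNat p n ! :=
      Nat.mul_le_mul_right _ (Nat.le_sub_one_of_lt hp.one_lt)
    omega
  rw [hu, Nat.cast_mul, map_mul, apply_natCast_eq_one_of_not_dvd v hp hv hnd, mul_one,
    Nat.cast_pow, map_pow]
  exact pow_le_pow_of_le_one hp0.le hv.le hle

theorem tendsto_apply_factorial : Tendsto (fun n : ℕ => v ((n ! : ℕ) : K)) atTop (𝓝 0) := by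
  obtain ⟨p, hp, hv⟩ := exists_prime_apply_lt_one v
  refine squeeze_zero (fun n => apply_nonneg v _) (fun n => ?_)
    ((tendsto_pow_atTop_nhds_zero_of_lt_one (apply_nonneg v (p : K)) hv).comp
      (Nat.tendsto_div_const_atTop hp.ne_zero))
  have h1 : p ^ (n / p) ∣ n ! := by
    have h2 : p ! ^ (n / p) ∣ (n / p * p)! := by
      simpa using Nat.prod_factorial_dvd_factorial_sum (Finset.range (n / p)) fun _ => p
    exact (pow_dvd_pow_of_dvd (Nat.dvd_factorial hp.pos le_rfl) _).trans
      (h2.trans (Nat.factorial_dvd_factorial (Nat.div_mul_le_self n p)))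
  simpa using apply_natCast_le_of_dvd v h1

theorem summable_euler (a : 𝓞 K) :
    Summable fun n : ℕ => (n ! : Completion v) * toCompletion v (a : K) ^ n := by
  refine NonarchimedeanAddGroup.summable_of_tendsto_cofinite_zero ?_
  rw [Nat.cofinite_eq_atTop]
  refine squeeze_zero_norm (fun n => ?_) (tendsto_apply_factorial v)
  rw [norm_mul, norm_pow, norm_toCompletion, ← map_natCast (toCompletion v), norm_toCompletion]
  exact mul_le_of_le_one_right (apply_nonneg v _)
    (pow_le_one₀ (apply_nonneg v _) (apply_integer_le_one v a))

variable {m : ℕ}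

theorem tendsto_truncatedForm {c : K} {μ : Fin m → K} {α : Fin m → 𝓞 K}
    (h : toCompletion v c + ∑ j, toCompletion v (μ j) * F v (α j : K) = 0) :
    Tendsto (fun n => v (truncatedForm c μ (fun j => (α j : K)) n)) atTop (𝓝 0) := by
  have h1 : Tendsto (fun n => toCompletion v (truncatedForm c μ (fun j => (α j : K)) n)) atTop
      (𝓝 (toCompletion v c + ∑ j, toCompletion v (μ j) * F v (α j : K))) := by
    simp only [truncatedForm, map_add, map_sum, map_mul, map_pow, map_natCast]
    exact tendsto_const_nhds.add (tendsto_finsetSum _ fun j _ =>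
      tendsto_const_nhds.mul (summable_euler v (α j)).hasSum.tendsto_sum_nat)
  rw [h] at h1
  simpa [norm_toCompletion] using h1.norm

theorem map_padeForm {R S : Type*} [CommRing R] [CommRing S] (f : R →+* S) (c : R)
    (μ α : Fin m → R) (M N : ℕ) (p : R[X]) :
    f (padeForm c μ α M N p) = padeForm (f c) (f ∘ μ) (f ∘ α) M N (p.map f) := by
  simp [padeForm, truncatedForm]

theorem apply_padeForm_le {c : 𝓞 K} {μ α : Fin m → 𝓞 K}
    (h : toCompletion v (c : K) + ∑ j, toCompletion v (μ j : K) * F v (α j : K) = 0)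
    {M l : ℕ} {p : (𝓞 K)[X]} (hp : p.natDegree ≤ M) (hdvd : ∀ j, (X - C (α j)) ^ l ∣ p)
    {B : ℝ} (hB0 : 0 ≤ B) (hB : ∀ j, v (α j : K) ≤ B) :
    v ((padeForm c μ α M 0 p : 𝓞 K) : K) ≤ v ((M ! : ℕ) : K) * v ((l ! : ℕ) : K) * B ^ l := by
  have hbound : ∀ N, v ((padeForm c μ α M N p - padeForm c μ α M 0 p : 𝓞 K) : K) ≤
      v ((M ! : ℕ) : K) * v ((l ! : ℕ) : K) * B ^ l := fun N => by
    rw [padeForm_sub _ _ _ _ _ hp, RingOfIntegers.coe_eq_algebraMap, map_mul, map_mul, map_natCast,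
      map_sum, mul_assoc]
    have hR : 0 ≤ v ((l ! : ℕ) : K) * B ^ l := mul_nonneg (apply_nonneg v _) (pow_nonneg hB0 _)
    refine mul_le_mul_of_nonneg_left (apply_sum_le_of_forall_le v hR fun j _ => ?_)
      (apply_nonneg v _)
    rw [map_mul, map_mul]
    refine (mul_le_of_le_one_left (apply_nonneg v _) (apply_integer_le_one v _)).trans ?_
    rw [map_sum]
    refine apply_sum_le_of_forall_le v hR fun n _ => ?_
    rcases lt_or_ge n l with hn | hn
    · rw [eval_hasseDeriv_eq_zero ((hdvd j).mul_left _) hn]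
      simpa using hR
    · rw [map_mul, map_mul, map_mul, map_mul, map_natCast, map_pow, map_pow]
      refine (mul_le_of_le_one_right (mul_nonneg (apply_nonneg v _)
        (pow_nonneg (apply_nonneg v _) _)) (apply_integer_le_one v _)).trans ?_
      refine mul_le_mul (apply_natCast_le_of_dvd v (Nat.factorial_dvd_factorial hn)) ?_
        (pow_nonneg (apply_nonneg v _) _) (apply_nonneg v _)
      exact (pow_le_pow_of_le_one (apply_nonneg v _) (apply_integer_le_one v _) hn).trans
        (pow_le_pow_left₀ (apply_nonneg v _) (hB j) _)
  have htend : Tendsto (fun N => v ((padeForm c μ α M N p : 𝓞 K) : K)) atTop (𝓝 0) := by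
    have h1 := tendsto_truncatedForm v (α := α) h
    have h2 : Tendsto (fun N => ∑ i ∈ Finset.range (M + 1),
        v (truncatedForm (c : K) (fun j => (μ j : K)) (fun j => (α j : K)) (N + i))) atTop (𝓝 0) := by
      simpa using tendsto_finsetSum (Finset.range (M + 1)) fun i _ =>
        h1.comp (tendsto_add_atTop_nat i)
    refine squeeze_zero (fun N => apply_nonneg v _) (fun N => ?_) h2
    rw [RingOfIntegers.coe_eq_algebraMap, map_padeForm (algebraMap (𝓞 K) K), padeForm]
    refine (apply_sum_le_of_forall_le v (Finset.sum_nonneg fun i _ => apply_nonneg v _)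
      fun i hi => ?_)
    rw [map_mul, map_mul, coeff_map]
    refine le_trans ?_ (Finset.single_le_sum
      (f := fun i => v (truncatedForm (c : K) (fun j => (μ j : K)) (fun j => (α j : K)) (N + i)))
      (fun i _ => apply_nonneg v _) hi)
    exact mul_le_of_le_one_left (apply_nonneg v _)
      (mul_le_one₀ (apply_integer_le_one v _) (apply_nonneg v _) (apply_natCast_le_one v _))
  -- Ultrametric inequality for `T(0) = T(N) - (T(N) - T(0))`; letting `N → ∞` removes `T(N)` from
  -- the maximum.
  have hle : ∀ N, v ((padeForm c μ α M 0 p : 𝓞 K) : K) ≤ max (v ((padeForm c μ α M N p : 𝓞 K) : K))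
      (v ((M ! : ℕ) : K) * v ((l ! : ℕ) : K) * B ^ l) := fun N => by
    have h1 := v.add_le ((padeForm c μ α M N p : 𝓞 K) : K)
      (-((padeForm c μ α M N p - padeForm c μ α M 0 p : 𝓞 K) : K))
    have h2 : ((padeForm c μ α M N p : 𝓞 K) : K) +
        -((padeForm c μ α M N p - padeForm c μ α M 0 p : 𝓞 K) : K) =
        ((padeForm c μ α M 0 p : 𝓞 K) : K) := by
      simp only [RingOfIntegers.coe_eq_algebraMap, map_sub]
      ring
    rw [map_neg_eq_map, h2] at h1
    exact h1.trans (max_le_max le_rfl (hbound N))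
  have := ge_of_tendsto' (htend.max tendsto_const_nhds) hle
  rwa [max_eq_right (mul_nonneg (mul_nonneg (apply_nonneg v _) (apply_nonneg v _))
    (pow_nonneg hB0 _))] at this

end FinitePlaces

end EulerSeries

namespace EulerSeries

open NumberField Polynomial Filter Topology

/-! ### Estimates at the Archimedean places. -/

section InfinitePlaces

variable {K : Type*} [Field K] (w : InfinitePlace K)

/-- The length of a polynomial grows by at most `1 + |a|` under multiplication by `X - a`. Bounding
every partial sum avoids tracking degrees. -/
theorem sum_apply_coeff_X_sub_C_mul_le {a : K} {q : K[X]} {B : ℝ}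
    (h : ∀ H, ∑ i ∈ Finset.range H, w (q.coeff i) ≤ B) (H : ℕ) :
    ∑ i ∈ Finset.range H, w (((X - C a) * q).coeff i) ≤ (1 + w a) * B := by
  have h1 : ∀ i, w (((X - C a) * q).coeff i) ≤ w ((X * q).coeff i) + w a * w (q.coeff i) :=
    fun i => by
      rw [sub_mul, coeff_sub, coeff_C_mul, ← map_mul]
      exact w.1.sub_le_add _ _
  have h2 : ∑ i ∈ Finset.range H, w ((X * q).coeff i) ≤ B := by
    rcases H with _ | H
    · simpa using h 0
    · rw [Finset.sum_range_succ']
      simpa using h H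
  calc _ ≤ ∑ i ∈ Finset.range H, (w ((X * q).coeff i) + w a * w (q.coeff i)) :=
        Finset.sum_le_sum fun i _ => h1 i
    _ ≤ B + w a * B := by
        rw [Finset.sum_add_distrib, ← Finset.mul_sum]
        exact add_le_add h2 (mul_le_mul_of_nonneg_left (h H) (apply_nonneg w _))
    _ = _ := by ring

theorem sum_apply_coeff_X_sub_C_pow_mul_le {a : K} {q : K[X]} {B : ℝ}
    (h : ∀ H, ∑ i ∈ Finset.range H, w (q.coeff i) ≤ B) (l H : ℕ) :
    ∑ i ∈ Finset.range H, w (((X - C a) ^ l * q).coeff i) ≤ (1 + w a) ^ l * B := by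
  induction l generalizing H with
  | zero => simpa using h H
  | succ l ih =>
    rw [pow_succ', pow_succ', mul_assoc, mul_assoc]
    exact sum_apply_coeff_X_sub_C_mul_le w ih H

theorem sum_apply_coeff_prod_X_sub_C_pow_mul_le {ι : Type*} (s : Finset ι) (α : ι → K) {q : K[X]}
    {B : ℝ} (h : ∀ H, ∑ i ∈ Finset.range H, w (q.coeff i) ≤ B) (l H : ℕ) :
    ∑ i ∈ Finset.range H, w (((∏ j ∈ s, (X - C (α j))) ^ l * q).coeff i) ≤
      (∏ j ∈ s, (1 + w (α j))) ^ l * B := by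
  classical
  induction s using Finset.induction_on generalizing H with
  | empty => simpa using h H
  | insert j s hj ih =>
    rw [Finset.prod_insert hj, Finset.prod_insert hj, mul_pow, mul_pow, mul_assoc, mul_assoc]
    exact sum_apply_coeff_X_sub_C_pow_mul_le w ih l H

theorem sum_range_factorial_le (h : ℕ) : ∑ n ∈ Finset.range h, n ! ≤ h ! := by
  induction h with
  | zero => simp
  | succ h ih =>
    rcases Nat.eq_zero_or_pos h with rfl | hh
    · simp
    · rw [Finset.sum_range_succ, Nat.factorial_succ]
      nlinarith [h.factorial_pos]

variable {m : ℕ}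

/-- The factor `h!` is kept exact because it cancels against `M! / h!` in `padeForm`; the power of
`Y` is made uniform in `h`. -/
theorem apply_truncatedForm_le {c : K} {μ α : Fin m → K} {Y : ℝ} (hY : 1 ≤ Y)
    (hα : ∀ j, w (α j) ≤ Y) {h M : ℕ} (hM : h ≤ M) :
    w (truncatedForm c μ α h) ≤ h ! * ((w c + ∑ j, w (μ j)) * Y ^ M) := by
  have h1 : ∀ j, w (∑ n ∈ Finset.range h, (n ! : K) * α j ^ n) ≤ h ! * Y ^ M := fun j => by
    calc w (∑ n ∈ Finset.range h, (n ! : K) * α j ^ n)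
        ≤ ∑ n ∈ Finset.range h, w ((n ! : K) * α j ^ n) := w.1.sum_le _ _
      _ ≤ ∑ n ∈ Finset.range h, (n ! : ℝ) * Y ^ M := by
          refine Finset.sum_le_sum fun n hn => ?_
          rw [map_mul, map_pow, InfinitePlace.map_natCast]
          refine mul_le_mul_of_nonneg_left ?_ (Nat.cast_nonneg _)
          exact (pow_le_pow_left₀ (apply_nonneg w _) (hα j) n).trans
            (pow_le_pow_right₀ hY ((Finset.mem_range.1 hn).le.trans hM))
      _ ≤ h ! * Y ^ M := by
          rw [← Finset.sum_mul]
          refine mul_le_mul_of_nonneg_right ?_ (by positivity)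
          exact_mod_cast sum_range_factorial_le h
  have h2 : (1 : ℝ) ≤ h ! * Y ^ M :=
    one_le_mul_of_one_le_of_one_le (by exact_mod_cast h.factorial_pos) (one_le_pow₀ hY)
  calc w (truncatedForm c μ α h)
      ≤ w c + ∑ j, w (μ j * ∑ n ∈ Finset.range h, (n ! : K) * α j ^ n) :=
        (w.1.add_le _ _).trans (add_le_add_right (w.1.sum_le _ _) _)
    _ ≤ w c * (h ! * Y ^ M) + ∑ j, w (μ j) * (h ! * Y ^ M) := by
        refine add_le_add (le_mul_of_one_le_right (apply_nonneg w _) h2)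
          (Finset.sum_le_sum fun j _ => ?_)
        rw [map_mul]
        exact mul_le_mul_of_nonneg_left (h1 j) (apply_nonneg w _)
    _ = _ := by rw [← Finset.sum_mul]; ring

theorem infinitePlace_apply_padeForm_le {c : K} {μ α : Fin m → K} {Y B : ℝ} (hY : 1 ≤ Y)
    (hα : ∀ j, w (α j) ≤ Y) {M : ℕ} {p : K[X]}
    (hp : ∀ H, ∑ i ∈ Finset.range H, w (p.coeff i) ≤ B) :
    w (padeForm c μ α M 0 p) ≤ M ! * ((w c + ∑ j, w (μ j)) * Y ^ M) * B := by
  have hΛ : 0 ≤ w c + ∑ j, w (μ j) :=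
    add_nonneg (apply_nonneg w _) (Finset.sum_nonneg fun j _ => apply_nonneg w _)
  calc w (padeForm c μ α M 0 p)
      ≤ ∑ h ∈ Finset.range (M + 1),
          w (p.coeff h * (M ! / h ! : ℕ) * truncatedForm c μ α (0 + h)) := w.1.sum_le _ _
    _ ≤ ∑ h ∈ Finset.range (M + 1), M ! * ((w c + ∑ j, w (μ j)) * Y ^ M) * w (p.coeff h) := by
        refine Finset.sum_le_sum fun h hh => ?_
        have hhM : h ≤ M := Nat.lt_succ_iff.1 (Finset.mem_range.1 hh)
        rw [map_mul, map_mul, InfinitePlace.map_natCast, zero_add]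
        calc _ ≤ w (p.coeff h) * (M ! / h ! : ℕ) * (h ! * ((w c + ∑ j, w (μ j)) * Y ^ M)) := by
              gcongr
              exact apply_truncatedForm_le w hY hα hhM
          _ = ((M ! / h ! * h ! : ℕ) : ℝ) * ((w c + ∑ j, w (μ j)) * Y ^ M) * w (p.coeff h) := by
              push_cast; ring
          _ = _ := by rw [Nat.div_mul_cancel (Nat.factorial_dvd_factorial hhM)]
    _ ≤ _ := by
        rw [← Finset.mul_sum]
        exact mul_le_mul_of_nonneg_left (hp _) (by positivity)

end InfinitePlaces

/-! ### Normalised absolute values and the product formula. -/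

section NormalizedNorms

variable {K : Type*} [Field K] [NumberField K]

theorem finrank_real_pos : (0 : ℝ) < Module.finrank ℚ K := by
  exact_mod_cast Module.finrank_pos

theorem infExponent_pos (w : InfinitePlace K) :
    (0 : ℝ) < (w.mult : ℝ) / (Module.finrank ℚ K : ℝ) :=
  div_pos (by exact_mod_cast w.mult_pos) finrank_real_pos

theorem sum_infExponent :
    ∑ w : InfinitePlace K, (w.mult : ℝ) / (Module.finrank ℚ K : ℝ) = 1 := by
  rw [← Finset.sum_div, ← Nat.cast_sum, InfinitePlace.sum_mult_eq,
    div_self finrank_real_pos.ne']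

theorem infExponent_le_one (w : InfinitePlace K) :
    (w.mult : ℝ) / (Module.finrank ℚ K : ℝ) ≤ 1 :=
  sum_infExponent (K := K) ▸ Finset.single_le_sum
    (f := fun w : InfinitePlace K => (w.mult : ℝ) / (Module.finrank ℚ K : ℝ))
    (fun w _ => (infExponent_pos w).le) (Finset.mem_univ w)

theorem infNorm_nonneg (w : InfinitePlace K) (x : K) : 0 ≤ infNorm w x :=
  Real.rpow_nonneg (apply_nonneg w x) _

theorem finNorm_nonneg (v : FinitePlace K) (x : K) : 0 ≤ finNorm v x :=
  Real.rpow_nonneg (apply_nonneg v x) _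

theorem finNorm_integer_le_one (v : FinitePlace K) (x : 𝓞 K) : finNorm v (x : K) ≤ 1 :=
  Real.rpow_le_one (apply_nonneg v _) (apply_integer_le_one v x) (by positivity)

theorem hasFiniteMulSupport_finNorm {x : K} (hx : x ≠ 0) :
    (fun v : FinitePlace K => finNorm v x).HasFiniteMulSupport :=
  (FinitePlace.hasFiniteMulSupport hx).fun_comp
    (g := fun y : ℝ => y ^ (1 / (Module.finrank ℚ K : ℝ))) (Real.one_rpow _)

theorem prod_infNorm_natCast (n : ℕ) (hn : n ≠ 0) :
    ∏ w : InfinitePlace K, infNorm w (n : K) = n := by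
  simp only [infNorm, InfinitePlace.map_natCast]
  rw [← Real.rpow_sum_of_pos (by exact_mod_cast Nat.pos_of_ne_zero hn), sum_infExponent,
    Real.rpow_one]

theorem prod_infNorm_mul_finprod_finNorm {x : K} (hx : x ≠ 0) :
    (∏ w : InfinitePlace K, infNorm w x) * ∏ᶠ v : FinitePlace K, finNorm v x = 1 := by
  have hs : (Function.mulSupport fun v : FinitePlace K => v x).Finite :=
    FinitePlace.hasFiniteMulSupport hx
  have h1 : ∏ᶠ v : FinitePlace K, finNorm v x =
      (∏ᶠ v : FinitePlace K, v x) ^ (1 / (Module.finrank ℚ K : ℝ)) := by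
    have hsub : (Function.mulSupport fun v : FinitePlace K => finNorm v x) ⊆
        (hs.toFinset : Set (FinitePlace K)) := fun v hv => by
      rw [hs.coe_toFinset]
      exact fun h => hv (by simp [finNorm, show v x = 1 from h])
    rw [finprod_eq_prod_of_mulSupport_subset _ hsub,
      finprod_eq_prod_of_mulSupport_subset _ (hs.coe_toFinset).ge,
      ← Real.finsetProd_rpow _ _ fun v _ => apply_nonneg v x]
    rfl
  have h2 : ∏ w : InfinitePlace K, infNorm w x =
      (∏ w : InfinitePlace K, w x ^ w.mult) ^ (1 / (Module.finrank ℚ K : ℝ)) := by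
    rw [← Real.finsetProd_rpow _ _ fun w _ => pow_nonneg (apply_nonneg w x) _]
    refine Finset.prod_congr rfl fun w _ => ?_
    rw [infNorm, ← Real.rpow_natCast, ← Real.rpow_mul (apply_nonneg w x), mul_one_div]
  rw [h1, h2, ← Real.mul_rpow, prod_abs_eq_one hx, Real.one_rpow]
  · exact Finset.prod_nonneg fun w _ => pow_nonneg (apply_nonneg w x) _
  · exact finprod_nonneg fun v => apply_nonneg v x

theorem finprod_subtype_mul_compl {f : FinitePlace K → ℝ} (hf : f.HasFiniteMulSupport)
    (V : Set (FinitePlace K)) :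
    (∏ᶠ v : V, f v) * ∏ᶠ v : (Vᶜ : Set (FinitePlace K)), f v = ∏ᶠ v, f v := by
  rw [finprod_set_coe_eq_finprod_mem, finprod_set_coe_eq_finprod_mem, ← finprod_mem_univ f,
    ← finprod_mem_mul_sdiff' (Set.subset_univ V) (by rw [Set.univ_inter]; exact hf), Set.compl_eq_univ_sdiff]

theorem one_le_infMax {m : ℕ} (α : Fin m → 𝓞 K) (w : InfinitePlace K) : 1 ≤ infMax α w :=
  le_max_left _ _

theorem infNorm_le_infMax {m : ℕ} (α : Fin m → 𝓞 K) (w : InfinitePlace K) (j : Fin m) :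
    infNorm w (α j : K) ≤ infMax α w :=
  (le_ciSup (f := fun j => infNorm w (α j : K)) (Set.finite_range _).bddAbove j).trans
    (le_max_right _ _)

theorem c₁_nonneg {m : ℕ} (α : Fin m → 𝓞 K) : 0 ≤ c₁ α := by
  refine Finset.prod_nonneg fun w _ => mul_nonneg ?_ (Finset.prod_nonneg fun i _ => ?_)
  · exact pow_nonneg (zero_le_one.trans (one_le_infMax α w)) _
  · exact add_nonneg (infNorm_nonneg w _) (zero_le_one.trans (one_le_infMax α w))

theorem iSup_finNorm_nonneg {m : ℕ} (α : Fin m → 𝓞 K) (v : FinitePlace K) :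
    0 ≤ ⨆ j, finNorm v (α j : K) :=
  Real.iSup_nonneg fun _ => finNorm_nonneg v _

theorem c₂_nonneg {m : ℕ} (α : Fin m → 𝓞 K) (V : Set (FinitePlace K)) : 0 ≤ c₂ α V :=
  mul_nonneg (c₁_nonneg α) (finprod_nonneg fun v => iSup_finNorm_nonneg α v)

theorem term_nonneg {m : ℕ} (α : Fin m → 𝓞 K) (V : Set (FinitePlace K)) (l : ℕ) :
    0 ≤ term α V l := by
  have h1 := c₂_nonneg α V
  have h2 : 0 ≤ ∏ᶠ v : V, finNorm (v : FinitePlace K) (((m * l)! * l ! : ℕ) : K) :=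
    finprod_nonneg fun v => finNorm_nonneg v.1 _
  unfold term
  positivity

end NormalizedNorms

end EulerSeries

namespace EulerSeries

open NumberField Polynomial Filter Topology

/-! ### Global estimate and part (a). -/

section Estimates

variable {K : Type*} [Field K] [NumberField K] {m : ℕ}

theorem map_prod_X_sub_C_pow_mul_X_pow {R S : Type*} [CommRing R] [CommRing S] (f : R →+* S)
    (α : Fin m → R) (l i : ℕ) :
    ((∏ j, (X - C (α j))) ^ l * X ^ i).map f = (∏ j, (X - C (f (α j)))) ^ l * X ^ i := by
  simp [Polynomial.map_prod]

theorem infNorm_padeForm_le (c : 𝓞 K) (μ α : Fin m → 𝓞 K) (w : InfinitePlace K) (l i : ℕ) :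
    infNorm w ((padeForm c μ α (m * l + m) 0 ((∏ j, (X - C (α j))) ^ l * X ^ i) : 𝓞 K) : K) ≤
      infNorm w (((m * l + m)! : ℕ) : K) *
        ((w (c : K) + ∑ j, w (μ j : K)) ^ ((w.mult : ℝ) / (Module.finrank ℚ K : ℝ)) *
          infMax α w ^ m) *
        (infMax α w ^ m * ∏ i, (infNorm w (α i : K) + infMax α w)) ^ l := by
  set s : ℝ := (w.mult : ℝ) / (Module.finrank ℚ K : ℝ) with hs
  have hs0 : 0 < s := infExponent_pos w
  have hs1 : s ≤ 1 := infExponent_le_one w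
  have hmax := one_le_infMax α w
  have hmax0 : 0 ≤ infMax α w := zero_le_one.trans hmax
  -- The estimate is made for the unnormalised absolute value and raised to the power `s` at the
  -- end, so `Y` is chosen with `Y ^ s = infMax α w`.
  set Y : ℝ := infMax α w ^ s⁻¹ with hY
  have hYs : Y ^ s = infMax α w := by
    rw [hY, ← Real.rpow_mul hmax0, inv_mul_cancel₀ hs0.ne', Real.rpow_one]
  have hY1 : 1 ≤ Y := Real.one_le_rpow hmax (inv_nonneg.2 hs0.le)
  have hY0 : 0 ≤ Y := zero_le_one.trans hY1
  have hα : ∀ j, w (α j : K) ≤ Y := fun j => by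
    have h1 : (w (α j : K)) ^ s ≤ Y ^ s := hYs.symm ▸ infNorm_le_infMax α w j
    exact (Real.rpow_le_rpow_iff (apply_nonneg w _) hY0 hs0).1 h1
  have hΛ : 0 ≤ w (c : K) + ∑ j, w (μ j : K) :=
    add_nonneg (apply_nonneg w _) (Finset.sum_nonneg fun j _ => apply_nonneg w _)
  have hX : ∀ H, ∑ h ∈ Finset.range H, w ((X ^ i : K[X]).coeff h) ≤ 1 := fun H => by
    have : ∀ h, w ((X ^ i : K[X]).coeff h) = if h = i then 1 else 0 := fun h => by
      rw [coeff_X_pow]; split_ifs <;> simp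
    simp only [this, Finset.sum_ite_eq']
    split_ifs <;> norm_num
  have hP : ∀ i : Fin m, 0 ≤ 1 + w (α i : K) := fun i => add_nonneg zero_le_one (apply_nonneg w _)
  have hP' : 0 ≤ ∏ i, (1 + w (α i : K)) := Finset.prod_nonneg fun i _ => hP i
  have hW : w ((padeForm c μ α (m * l + m) 0 ((∏ j, (X - C (α j))) ^ l * X ^ i) : 𝓞 K) : K) ≤
      (m * l + m)! * ((w (c : K) + ∑ j, w (μ j : K)) * Y ^ (m * l + m)) *
        (∏ i, (1 + w (α i : K))) ^ l := by
    rw [RingOfIntegers.coe_eq_algebraMap, map_padeForm (algebraMap (𝓞 K) K),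
      map_prod_X_sub_C_pow_mul_X_pow]
    refine infinitePlace_apply_padeForm_le w hY1 hα fun H => ?_
    simpa using sum_apply_coeff_prod_X_sub_C_pow_mul_le w Finset.univ (fun j => (α j : K)) hX l H
  -- Since `s ≤ 1`, the map `t ↦ t ^ s` is subadditive.
  have hprod : (∏ i, (1 + w (α i : K))) ^ s ≤ ∏ i, (infNorm w (α i : K) + infMax α w) := by
    rw [← Real.finsetProd_rpow _ _ fun i _ => hP i]
    refine Finset.prod_le_prod (fun i _ => Real.rpow_nonneg (hP i) _) fun i _ => ?_
    calc (1 + w (α i : K)) ^ s ≤ 1 ^ s + w (α i : K) ^ s :=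
          Real.rpow_add_le_add_rpow zero_le_one (apply_nonneg w _) hs0.le hs1
      _ ≤ infMax α w + infNorm w (α i : K) := by
          rw [Real.one_rpow]; exact add_le_add hmax le_rfl
      _ = _ := add_comm _ _
  have hnat : infNorm w (((m * l + m)! : ℕ) : K) = ((m * l + m)! : ℝ) ^ s := by
    rw [infNorm, InfinitePlace.map_natCast]
  have hpow : ∀ {x : ℝ}, 0 ≤ x → ∀ n : ℕ, (x ^ n) ^ s = (x ^ s) ^ n := fun hx n => by
    rw [← Real.rpow_natCast, ← Real.rpow_natCast, ← Real.rpow_mul hx, ← Real.rpow_mul hx, mul_comm]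
  calc _ ≤ ((m * l + m)! * ((w (c : K) + ∑ j, w (μ j : K)) * Y ^ (m * l + m)) *
        (∏ i, (1 + w (α i : K))) ^ l) ^ s := Real.rpow_le_rpow (apply_nonneg w _) hW hs0.le
    _ = ((m * l + m)! : ℝ) ^ s * ((w (c : K) + ∑ j, w (μ j : K)) ^ s *
          infMax α w ^ (m * l + m)) * ((∏ i, (1 + w (α i : K))) ^ s) ^ l := by
        rw [Real.mul_rpow (by positivity) (by positivity), Real.mul_rpow (by positivity)
          (by positivity), Real.mul_rpow hΛ (by positivity), hpow hY0, hYs, hpow hP']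
    _ ≤ ((m * l + m)! : ℝ) ^ s * ((w (c : K) + ∑ j, w (μ j : K)) ^ s *
          infMax α w ^ (m * l + m)) * (∏ i, (infNorm w (α i : K) + infMax α w)) ^ l := by
        gcongr
    _ = _ := by
        rw [hnat, pow_add, mul_pow (infMax α w ^ m), pow_mul]
        ring

theorem exists_prod_infNorm_padeForm_le (c : 𝓞 K) (μ α : Fin m → 𝓞 K) :
    ∃ D : ℝ, 0 ≤ D ∧ ∀ l i : ℕ, ∏ w : InfinitePlace K, infNorm w
      ((padeForm c μ α (m * l + m) 0 ((∏ j, (X - C (α j))) ^ l * X ^ i) : 𝓞 K) : K) ≤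
        D * ((m * l + m)! * c₁ α ^ l) := by
  refine ⟨∏ w : InfinitePlace K, ((w (c : K) + ∑ j, w (μ j : K)) ^
    ((w.mult : ℝ) / (Module.finrank ℚ K : ℝ)) * infMax α w ^ m),
    Finset.prod_nonneg fun w _ => mul_nonneg (Real.rpow_nonneg (add_nonneg (apply_nonneg w _)
      (Finset.sum_nonneg fun j _ => apply_nonneg w _)) _)
      (pow_nonneg (zero_le_one.trans (one_le_infMax α w)) _), fun l i => ?_⟩
  refine (Finset.prod_le_prod (fun w _ => infNorm_nonneg w _)
    fun w _ => infNorm_padeForm_le c μ α w l i).trans_eq ?_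
  rw [Finset.prod_mul_distrib, Finset.prod_mul_distrib, prod_infNorm_natCast _
    (Nat.factorial_ne_zero _), Finset.prod_pow, c₁]
  ring

theorem natDegree_prod_X_sub_C_pow_mul_X_pow_le {R : Type*} [CommRing R] [Nontrivial R]
    (α : Fin m → R) (l : ℕ) {i : ℕ} (hi : i ≤ m) :
    ((∏ j, (X - C (α j))) ^ l * X ^ i).natDegree ≤ m * l + m := by
  refine natDegree_mul_le.trans (add_le_add ?_ ((natDegree_X_pow_le i).trans hi))
  rw [(monic_prod_X_sub_C α Finset.univ).natDegree_pow, natDegree_finsetProd_X_sub_C_eq_card]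
  simp [mul_comm]

theorem finNorm_padeForm_le {c : 𝓞 K} {μ α : Fin m → 𝓞 K} {v : FinitePlace K}
    (h : toCompletion v (c : K) + ∑ j, toCompletion v (μ j : K) * F v (α j : K) = 0)
    (l : ℕ) {i : ℕ} (hi : i ≤ m) :
    finNorm v ((padeForm c μ α (m * l + m) 0 ((∏ j, (X - C (α j))) ^ l * X ^ i) : 𝓞 K) : K) ≤
      finNorm v (((m * l)! * l ! : ℕ) : K) * (⨆ j, finNorm v (α j : K)) ^ l := by
  set e : ℝ := 1 / (Module.finrank ℚ K : ℝ) with he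
  have he0 : 0 < e := one_div_pos.2 finrank_real_pos
  set S : ℝ := ⨆ j, finNorm v (α j : K) with hS
  have hS0 : 0 ≤ S := iSup_finNorm_nonneg α v
  have hSe : (S ^ e⁻¹) ^ e = S := by
    rw [← Real.rpow_mul hS0, inv_mul_cancel₀ he0.ne', Real.rpow_one]
  have hB0 : 0 ≤ S ^ e⁻¹ := Real.rpow_nonneg hS0 _
  have hB : ∀ j, v (α j : K) ≤ S ^ e⁻¹ := fun j => by
    refine (Real.rpow_le_rpow_iff (apply_nonneg v _) hB0 he0).1 ?_
    rw [hSe]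
    exact le_ciSup (f := fun j => finNorm v (α j : K)) (Set.finite_range _).bddAbove j
  have h1 := apply_padeForm_le v h (natDegree_prod_X_sub_C_pow_mul_X_pow_le α l hi)
    (fun j => (pow_dvd_pow_of_dvd (Finset.dvd_prod_of_mem (fun j => X - C (α j))
      (Finset.mem_univ j)) l).mul_right (X ^ i)) hB0 hB
  have h2 : v (((m * l + m)! : ℕ) : K) ≤ v (((m * l)! : ℕ) : K) :=
    apply_natCast_le_of_dvd v (Nat.factorial_dvd_factorial (Nat.le_add_right _ _))
  have h3 := h1.trans (mul_le_mul_of_nonneg_right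
    (mul_le_mul_of_nonneg_right h2 (apply_nonneg v ((l ! : ℕ) : K))) (pow_nonneg hB0 l))
  rw [← map_mul, ← Nat.cast_mul] at h3
  refine (Real.rpow_le_rpow (apply_nonneg v _) h3 he0.le).trans_eq ?_
  rw [Real.mul_rpow (apply_nonneg v _) (pow_nonneg hB0 l), ← Real.rpow_natCast,
    ← Real.rpow_mul hB0, mul_comm (l : ℝ) e, Real.rpow_mul hB0, hSe, Real.rpow_natCast]
  rfl

theorem hasFiniteMulSupport_iSup_finNorm (hm : 1 ≤ m) {α : Fin m → 𝓞 K} (hα : ∀ j, α j ≠ 0) :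
    (fun v : FinitePlace K => ⨆ j, finNorm v (α j : K)).HasFiniteMulSupport := by
  have : Nonempty (Fin m) := ⟨⟨0, hm⟩⟩
  exact Function.HasFiniteMulSupport.iSup fun j =>
    hasFiniteMulSupport_finNorm (RingOfIntegers.coe_ne_zero_iff.2 (hα j))

theorem finprod_finNorm_le_finprod_subtype {x : 𝓞 K} (hx : x ≠ 0) (V : Set (FinitePlace K)) :
    ∏ᶠ v : FinitePlace K, finNorm v (x : K) ≤ ∏ᶠ v : V, finNorm (v : FinitePlace K) (x : K) := by
  have hf := hasFiniteMulSupport_finNorm (RingOfIntegers.coe_ne_zero_iff.2 hx)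
  rw [← finprod_subtype_mul_compl hf V]
  refine mul_le_of_le_one_right (finprod_nonneg fun v => finNorm_nonneg v.1 _) ?_
  rw [← finprod_one (α := (Vᶜ : Set (FinitePlace K)))]
  exact finprod_le_finprod (hf.fun_comp_of_injective Subtype.val_injective)
    (fun v => finNorm_nonneg v.1 _) (by fun_prop) fun v => finNorm_integer_le_one v.1 x

theorem exists_linearForm_ne_zero (hm : 1 ≤ m) {α : Fin m → 𝓞 K} (hα : ∀ j, α j ≠ 0)
    (hinj : Function.Injective α) {c : 𝓞 K} {μ : Fin m → 𝓞 K} (hne : c ≠ 0 ∨ ∃ j, μ j ≠ 0)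
    {V : Set (FinitePlace K)} (hV : LimsupCondition α V) :
    ∃ v ∈ V, toCompletion v (c : K) + ∑ j, toCompletion v (μ j : K) * F v (α j : K) ≠ 0 := by
  by_contra! hzero
  obtain ⟨D, hD, hinf⟩ := exists_prod_infNorm_padeForm_le c μ α
  -- The threshold makes `D * term < 1`; `D + 1` also covers `D = 0`.
  have hε : Filter.limsup (fun l : ℕ => ((term α V l : ℝ) : EReal)) atTop <
      ((1 / (D + 1) : ℝ) : EReal) := by
    rw [show Filter.limsup _ _ = (0 : EReal) from hV]
    exact_mod_cast (by positivity : 0 < 1 / (D + 1))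
  obtain ⟨l₀, hl₀⟩ := eventually_atTop.1 (eventually_lt_of_limsup_lt hε)
  obtain ⟨l, hl, i, hi, hΦ⟩ := exists_padeFunctional_pow_ne_zero (K := K) hm (c := (c : K))
    (μ := fun j => (μ j : K)) (α := fun j => (α j : K))
    (hne.imp RingOfIntegers.coe_ne_zero_iff.2 fun ⟨j, hj⟩ =>
      ⟨j, RingOfIntegers.coe_ne_zero_iff.2 hj⟩)
    (fun j => RingOfIntegers.coe_ne_zero_iff.2 (hα j))
    (RingOfIntegers.coe_injective.comp hinj) l₀
  have hterm : term α V l < 1 / (D + 1) := by exact_mod_cast hl₀ l hl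
  set W : 𝓞 K := padeForm c μ α (m * l + m) 0 ((∏ j, (X - C (α j))) ^ l * X ^ i) with hW
  have hWne : W ≠ 0 := by
    rw [← RingOfIntegers.coe_ne_zero_iff (K := K), hW, map_padeForm (algebraMap (𝓞 K) K), map_prod_X_sub_C_pow_mul_X_pow, padeForm_zero]
    · exact mul_ne_zero (by exact_mod_cast Nat.factorial_ne_zero _) hΦ
    · exact natDegree_prod_X_sub_C_pow_mul_X_pow_le _ l hi.le
  have hWK : (W : K) ≠ 0 := RingOfIntegers.coe_ne_zero_iff.2 hWne
  have hnat : (((m * l)! * l ! : ℕ) : K) ≠ 0 := by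
    exact_mod_cast mul_ne_zero (Nat.factorial_ne_zero _) (Nat.factorial_ne_zero _)
  have hsup : (fun v : V => ⨆ j, finNorm (v : FinitePlace K) (α j : K)).HasFiniteMulSupport :=
    (hasFiniteMulSupport_iSup_finNorm hm hα).comp_of_injective
      (g := ((↑) : V → FinitePlace K)) Subtype.val_injective
  have hsupl : (fun v : V =>
      (⨆ j, finNorm (v : FinitePlace K) (α j : K)) ^ l).HasFiniteMulSupport := hsup.pow l
  have hfac : (fun v : V =>
      finNorm (v : FinitePlace K) (((m * l)! * l ! : ℕ) : K)).HasFiniteMulSupport :=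
    (hasFiniteMulSupport_finNorm hnat).fun_comp_of_injective Subtype.val_injective
  have hfin : ∏ᶠ v : FinitePlace K, finNorm v (W : K) ≤
      (∏ᶠ v : V, finNorm (v : FinitePlace K) (((m * l)! * l ! : ℕ) : K)) *
        (∏ᶠ v : V, ⨆ j, finNorm (v : FinitePlace K) (α j : K)) ^ l := by
    refine (finprod_finNorm_le_finprod_subtype hWne V).trans ?_
    rw [finprod_pow hsup, ← finprod_mul_distrib hfac hsupl]
    exact finprod_le_finprod ((hasFiniteMulSupport_finNorm hWK).fun_comp_of_injective
      Subtype.val_injective) (fun v => finNorm_nonneg v.1 _) (hfac.mul hsupl)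
      fun v => finNorm_padeForm_le (hzero v.1 v.2) l hi.le
  -- Of the factor `(m l + m) ^ κ` in the condition, only this lower bound is needed.
  have hpos : (1 : ℝ) ≤ ((m * l + m : ℕ) : ℝ) ^ Module.finrank ℚ K :=
    one_le_pow₀ (by exact_mod_cast hm.trans (Nat.le_add_left _ _))
  have hP0 : 0 ≤ ∏ᶠ v : V, finNorm (v : FinitePlace K) (((m * l)! * l ! : ℕ) : K) :=
    finprod_nonneg fun v => finNorm_nonneg v.1 _
  have hQ0 : 0 ≤ ∏ᶠ v : V, ⨆ j, finNorm (v : FinitePlace K) (α j : K) :=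
    finprod_nonneg fun v => iSup_finNorm_nonneg α v.1
  have hc₁ := c₁_nonneg α
  have hle : (1 : ℝ) ≤ D * term α V l := by
    calc (1 : ℝ) = (∏ w : InfinitePlace K, infNorm w (W : K)) *
          ∏ᶠ v : FinitePlace K, finNorm v (W : K) := (prod_infNorm_mul_finprod_finNorm hWK).symm
      _ ≤ D * ((m * l + m)! * c₁ α ^ l) *
          ((∏ᶠ v : V, finNorm (v : FinitePlace K) (((m * l)! * l ! : ℕ) : K)) *
            (∏ᶠ v : V, ⨆ j, finNorm (v : FinitePlace K) (α j : K)) ^ l) :=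
        mul_le_mul (hinf l i) hfin (finprod_nonneg fun v => finNorm_nonneg v _) (by positivity)
      _ = D * (c₂ α V ^ l * 1 * ((m * l + m)! : ℝ) *
          ∏ᶠ v : V, finNorm (v : FinitePlace K) (((m * l)! * l ! : ℕ) : K)) := by
        rw [c₂, mul_pow]; ring
      _ ≤ D * term α V l := by
        have := c₂_nonneg α V
        unfold term
        gcongr
  have h1 : D * term α V l ≤ D * (1 / (D + 1)) := mul_le_mul_of_nonneg_left hterm.le hD
  have h2 : D * (1 / (D + 1)) < 1 := by
    rw [mul_one_div, div_lt_one (by positivity)]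
    linarith
  linarith

end Estimates

/-! ### Part (b): sets of places with finite complement. -/

section CofinitePlaces

variable {K : Type*} [Field K] [NumberField K] {m : ℕ}

theorem exists_pow_le_finNorm (v : FinitePlace K) (m : ℕ) :
    ∃ b : ℝ, 0 < b ∧ ∀ l : ℕ, b ^ l ≤ finNorm v (((m * l)! * l ! : ℕ) : K) := by
  obtain ⟨b, hb, h⟩ := exists_le_apply_factorial v
  refine ⟨(b ^ (m + 1)) ^ (1 / (Module.finrank ℚ K : ℝ)), by positivity, fun l => ?_⟩
  rw [← Real.rpow_natCast, ← Real.rpow_mul (by positivity), mul_comm, Real.rpow_mul (by positivity),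
    Real.rpow_natCast]
  refine Real.rpow_le_rpow (by positivity) ?_ (by positivity)
  rw [Nat.cast_mul, map_mul, ← pow_mul, add_mul, one_mul, pow_add]
  exact mul_le_mul (h _) (h _) (by positivity) (apply_nonneg v _)

theorem exists_pow_le_finprod_finNorm {S : Set (FinitePlace K)} (hS : S.Finite) (m : ℕ) :
    ∃ b : ℝ, 0 < b ∧ ∀ l : ℕ,
      b ^ l ≤ ∏ᶠ v : S, finNorm (v : FinitePlace K) (((m * l)! * l ! : ℕ) : K) := by
  choose b hb h using fun v : FinitePlace K => exists_pow_le_finNorm v m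
  have : Fintype S := hS.fintype
  refine ⟨∏ v : S, b v, Finset.prod_pos fun v _ => hb v, fun l => ?_⟩
  rw [finprod_eq_prod_of_fintype, ← Finset.prod_pow]
  exact Finset.prod_le_prod (fun v _ => pow_nonneg (hb v).le l) fun v _ => h v l

theorem finprod_finNorm_natCast {n : ℕ} (hn : n ≠ 0) :
    ∏ᶠ v : FinitePlace K, finNorm v (n : K) = (n : ℝ)⁻¹ := by
  have h1 := prod_infNorm_mul_finprod_finNorm (K := K) (x := n) (by exact_mod_cast hn)
  rw [prod_infNorm_natCast n hn] at h1
  exact eq_inv_of_mul_eq_one_right h1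

theorem limsupCondition_of_finite_compl (α : Fin m → 𝓞 K) {V : Set (FinitePlace K)}
    (hV : Vᶜ.Finite) : LimsupCondition α V := by
  obtain ⟨b, hb, hbl⟩ := exists_pow_le_finprod_finNorm hV m
  have hc := c₂_nonneg α V
  set κ := Module.finrank ℚ K with hκ
  have hbound : ∀ l : ℕ, term α V l ≤
      (m : ℝ) ^ (κ + m) * ((c₂ α V / b * 2 ^ (κ + m)) ^ l / (l ! : ℝ)) := fun l => by
    set n : ℕ := (m * l)! * l ! with hn
    have hn0 : n ≠ 0 := mul_ne_zero (Nat.factorial_ne_zero _) (Nat.factorial_ne_zero _)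
    have hP0 : 0 ≤ ∏ᶠ v : V, finNorm (v : FinitePlace K) (n : K) :=
      finprod_nonneg fun v => finNorm_nonneg v.1 _
    -- The product over all finite places is `1 / n`, and the complement of `V` contributes at least
    -- `b ^ l`.
    have hP : ∏ᶠ v : V, finNorm (v : FinitePlace K) (n : K) ≤ 1 / (n * b ^ l) := by
      have h1 := finprod_subtype_mul_compl
        (hasFiniteMulSupport_finNorm (K := K) (x := n) (by exact_mod_cast hn0)) V
      rw [finprod_finNorm_natCast hn0] at h1
      have h2 := mul_le_mul_of_nonneg_left (hbl l) hP0
      rw [h1] at h2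
      rw [one_div, mul_inv]
      exact (le_mul_inv_iff₀ (pow_pos hb l)).2 h2
    have hfac : ((m * l + m)! : ℝ) ≤ (m * l)! * ((m * l + m : ℕ) : ℝ) ^ m := by
      rw [← Nat.factorial_mul_ascFactorial]
      exact_mod_cast Nat.mul_le_mul_left _ (Nat.ascFactorial_le_pow_add _ _)
    -- Absorbs the polynomial factors into a geometric one, leaving a bound of the form `C * x ^ l /
    -- l!`.
    have hlin : ((m * l + m : ℕ) : ℝ) ≤ m * 2 ^ l := by
      have h1 : l + 1 ≤ 2 ^ l := Nat.lt_two_pow_self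
      exact_mod_cast (by calc m * l + m = m * (l + 1) := by ring
                          _ ≤ m * 2 ^ l := Nat.mul_le_mul_left _ h1)
    have hml : ((m * l)! : ℝ) ≠ 0 := by exact_mod_cast Nat.factorial_ne_zero _
    have hll : (l ! : ℝ) ≠ 0 := by exact_mod_cast Nat.factorial_ne_zero _
    calc term α V l ≤ c₂ α V ^ l * ((m * l + m : ℕ) : ℝ) ^ κ *
          ((m * l)! * ((m * l + m : ℕ) : ℝ) ^ m) * (1 / (n * b ^ l)) := by
          unfold term
          gcongr
      _ = c₂ α V ^ l * ((m * l + m : ℕ) : ℝ) ^ (κ + m) / (b ^ l * l !) := by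
          rw [hn, pow_add]
          push_cast
          field_simp
      _ ≤ c₂ α V ^ l * (m * 2 ^ l) ^ (κ + m) / (b ^ l * l !) := by gcongr
      _ = _ := by
          rw [mul_pow, mul_pow, div_pow, ← pow_mul, ← pow_mul, mul_comm l]
          field_simp
  have htend : Tendsto (term α V) atTop (𝓝 0) := by
    refine squeeze_zero (term_nonneg α V) hbound ?_
    simpa using (FloorSemiring.tendsto_pow_div_factorial_atTop
      (c₂ α V / b * 2 ^ (κ + m))).const_mul ((m : ℝ) ^ (κ + m))
  have := (continuous_coe_real_ereal.tendsto 0).comp htend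
  exact this.limsup_eq

end CofinitePlaces

end EulerSeries

theorem mainTheorem1 {K : Type*} [Field K] [NumberField K] {m : ℕ} (hm : 1 ≤ m)
    (α : Fin m → NumberField.RingOfIntegers K) (hα : ∀ j, α j ≠ 0)
    (hα' : Function.Injective α) :
    -- the series defining `F_v(α_j)` converge at every non-Archimedean place
    (∀ (v : NumberField.FinitePlace K) (j : Fin m),
      Summable fun n : ℕ =>
        (n ! : EulerSeries.Completion v) * EulerSeries.toCompletion v (α j : K) ^ n) ∧
    (∀ lam : Fin (m + 1) → NumberField.RingOfIntegers K, (∃ j, lam j ≠ 0) →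
      ∀ V : Set (NumberField.FinitePlace K), EulerSeries.LimsupCondition α V →
        ∃ v ∈ V,
          EulerSeries.toCompletion v (lam 0 : K) +
            ∑ j : Fin m, EulerSeries.toCompletion v (lam j.succ : K) *
              EulerSeries.F v (α j : K) ≠ 0) ∧
    (∀ V : Set (NumberField.FinitePlace K), Vᶜ.Finite → EulerSeries.LimsupCondition α V) :=
  ⟨fun v j => EulerSeries.summable_euler v (α j),
    fun lam hlam V hV => EulerSeries.exists_linearForm_ne_zero hm hα hα' (c := lam 0)
      (μ := fun j => lam j.succ) (Fin.exists_fin_succ.1 hlam) hV,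
    fun _ hV => EulerSeries.limsupCondition_of_finite_compl α hV⟩
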